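/- Let $n\ge 1$ be an integer. There is a constant $C$, depending only on $n$, such that the following holds for every real number $r\ge 1$. Let $\mathcal B^n$ denote the closed Euclidean unit ball centered at the origin of $\mathbb R^n$, and let $\mathcal H_r$ be the set of all $(n-1)$-dimensional linear subspaces of $\mathbb R^n$ that contain $n-1$ linearly independent points of $r\mathcal B^n\cap\mathbb Z^n$. Then $r\mathcal B^n\cap\mathbb Z^n$ and $\mathcal H_r$ are finite, $\mathcal H_r$ is non-empty, and the average number of lattice points of $r\mathcal B^n$ in the members of $\mathcal H_r$ satisfies $$s_r=\frac{1}{|\mathcal H_r|}\sum_{H\in\mathcal H_r}|H\cap r\mathcal B^n\cap\mathbb Z^n|\le C.$$ -/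

import Mathlib

/-- The points of the integer lattice `ℤⁿ` lying in the closed Euclidean ball of radius `r`
centered at the origin of `ℝⁿ`. -/
def latticeBall (n : ℕ) (r : ℝ) : Set (EuclideanSpace ℝ (Fin n)) :=
  {x | x ∈ Metric.closedBall 0 r ∧ ∀ i, ∃ z : ℤ, x i = (z : ℝ)}

/-- The set of all `(n-1)`-dimensional linear subspaces of `ℝⁿ` that contain `n - 1` linearly
independent lattice points from the ball of radius `r` (meaningful for `1 ≤ n`). -/
def latticeHyperplanes (n : ℕ) (r : ℝ) : Set (Submodule ℝ (EuclideanSpace ℝ (Fin n))) :=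
  {H | Module.finrank ℝ H = n - 1 ∧
    ∃ v : Fin (n - 1) → EuclideanSpace ℝ (Fin n),
      LinearIndependent ℝ v ∧ ∀ i, v i ∈ H ∧ v i ∈ latticeBall n r}

/-- The average, over the hyperplanes `H` in `latticeHyperplanes n r`, of the number of lattice
points in the intersection of `H` with the ball of radius `r`. -/
noncomputable def averageLatticePoints (n : ℕ) (r : ℝ) : ℝ :=
  (1 / ((latticeHyperplanes n r).ncard : ℝ)) *
    ∑ᶠ H ∈ latticeHyperplanes n r,
      (((H : Set (EuclideanSpace ℝ (Fin n))) ∩ latticeBall n r).ncard : ℝ)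

/-!
Write `n = m + 1` and let `N` be the set of lattice points in the ball of radius `r`. Both the sum
of the numbers `|H ∩ N|` and the number of hyperplanes turn out to be of the order of `r ^ (n * m)`.

*The sum.* If `x ≠ 0` is a lattice point of `H ∩ N`, it can be exchanged into a basis of `H` made of
points of `N`. The pair `(H, x)` is recovered from the new basis and the position of `x` in it, so
there are at most `m * |N| ^ m = O(r ^ (n * m))` such pairs (`sum_card_sectionPoints_le`).

*The number of hyperplanes.* Let `a` be a primitive integer normal vector of `H`. Every level
`a ⬝ᵥ y = j` with `|j| ≤ ‖a‖ * r` contains a lattice point of size `O(r)`, and the translates of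
`H ∩ N` by these points are disjoint and lie in a box of side `O(r)`. Hence
`‖a‖ * |H ∩ N| = O(r ^ m)` (`abs_normal_mul_card_sectionPoints_le`).

The vectors `e_k + 2 u_k` with `k < m` are linearly independent for all integer vectors `u_k`, as
one sees modulo `2`; this gives at least `c * r ^ (n * m)` linearly independent families in `N`.
The families whose span has a normal vector `a` with `‖a‖ ≤ δ * r ^ m` number at most
`∑ |H ∩ N| ^ m`, summed over these `a`, which is `O(∑ (r ^ m / ‖a‖) ^ m) = O(δ * r ^ (n * m))`
because there are `O(k ^ m)` vectors of sup norm `k` (`card_shortNormalParameters_le`). For small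
`δ` at least half of the families are left. They span hyperplanes with `|H ∩ N| = O(1 / δ)`, each of
which arises from a bounded number of families, so there are at least `c' * r ^ (n * m)`
hyperplanes (`exists_mul_pow_le_card_latticeHyperplanes`).
-/

/-! ### Lattice points as integer vectors -/

/-- The point of `ℝⁿ` with the given integer coordinates. -/
noncomputable def intVec {n : ℕ} (z : Fin n → ℤ) : EuclideanSpace ℝ (Fin n) :=
  WithLp.toLp 2 fun i => (z i : ℝ)

@[simp] lemma intVec_apply {n : ℕ} (z : Fin n → ℤ) (i : Fin n) : intVec z i = (z i : ℝ) := rfl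

lemma intVec_injective {n : ℕ} : Function.Injective (intVec (n := n)) := by
  intro z w h
  funext i
  have := congrArg (fun x : EuclideanSpace ℝ (Fin n) => x i) h
  simpa using this

/-- The integer vectors all of whose coordinates have absolute value at most `R`. -/
noncomputable def intBox (n : ℕ) (R : ℝ) : Finset (Fin n → ℤ) :=
  Fintype.piFinset fun _ => Finset.Icc (-⌊R⌋) ⌊R⌋

lemma mem_intBox {n : ℕ} {R : ℝ} {z : Fin n → ℤ} : z ∈ intBox n R ↔ ∀ i, |(z i : ℝ)| ≤ R := by
  simp only [intBox, Fintype.mem_piFinset, Finset.mem_Icc]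
  refine forall_congr' fun i => ?_
  rw [← abs_le, Int.le_floor, Int.cast_abs]

lemma card_intBox {n : ℕ} {R : ℝ} (hR : 0 ≤ R) :
    ((intBox n R).card : ℝ) = (2 * (⌊R⌋ : ℝ) + 1) ^ n := by
  have h0 : 0 ≤ ⌊R⌋ := Int.floor_nonneg.2 hR
  have h1 : (((⌊R⌋ + 1 - -⌊R⌋).toNat : ℕ) : ℝ) = 2 * (⌊R⌋ : ℝ) + 1 := by
    have : (((⌊R⌋ + 1 - -⌊R⌋).toNat : ℕ) : ℤ) = 2 * ⌊R⌋ + 1 := by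
      rw [Int.toNat_of_nonneg (by omega)]; ring
    exact_mod_cast this
  simp only [intBox, Fintype.card_piFinset, Int.card_Icc, Finset.prod_const, Finset.card_univ,
    Fintype.card_fin, Nat.cast_pow, h1]

lemma card_intBox_le {n : ℕ} {R : ℝ} (hR : 0 ≤ R) :
    ((intBox n R).card : ℝ) ≤ (2 * R + 1) ^ n := by
  have h : (0 : ℝ) ≤ (⌊R⌋ : ℝ) := by exact_mod_cast Int.floor_nonneg.2 hR
  rw [card_intBox hR]
  gcongr
  exact Int.floor_le R

lemma pow_le_card_intBox {n : ℕ} {R : ℝ} (hR : 0 ≤ R) : R ^ n ≤ (intBox n R).card := by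
  have h : (0 : ℝ) ≤ (⌊R⌋ : ℝ) := by exact_mod_cast Int.floor_nonneg.2 hR
  have h1 := Int.lt_floor_add_one R
  rw [card_intBox hR]
  gcongr
  linarith

/-- The coordinate vectors of the lattice points of `H` in the ball of radius `r`. -/
noncomputable def sectionPoints {n : ℕ} (r : ℝ) (H : Submodule ℝ (EuclideanSpace ℝ (Fin n))) :
    Finset (Fin n → ℤ) :=
  open Classical in (intBox n r).filter fun z => intVec z ∈ H ∧ ‖intVec z‖ ≤ r

lemma mem_sectionPoints {n : ℕ} {r : ℝ} {H : Submodule ℝ (EuclideanSpace ℝ (Fin n))}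
    {z : Fin n → ℤ} : z ∈ sectionPoints r H ↔ intVec z ∈ H ∧ ‖intVec z‖ ≤ r := by
  classical
  simp only [sectionPoints, Finset.mem_filter, mem_intBox, and_iff_right_iff_imp]
  rintro ⟨-, h⟩ i
  have := PiLp.norm_apply_le (intVec z) i
  simp only [intVec_apply, Real.norm_eq_abs] at this
  exact this.trans h

lemma sectionPoints_subset_intBox {n : ℕ} (r : ℝ) (H : Submodule ℝ (EuclideanSpace ℝ (Fin n))) :
    sectionPoints r H ⊆ intBox n r := by
  classical
  exact Finset.filter_subset _ _

lemma mem_latticeBall_iff {n : ℕ} {r : ℝ} {x : EuclideanSpace ℝ (Fin n)} :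
    x ∈ latticeBall n r ↔ ∃ z, intVec z = x ∧ ‖intVec z‖ ≤ r := by
  simp only [latticeBall, Set.mem_ofPred_eq, mem_closedBall_zero_iff]
  constructor
  · rintro ⟨hx, hz⟩
    choose z hz using hz
    have : intVec z = x := by ext i; simp [hz]
    exact ⟨z, this, this ▸ hx⟩
  · rintro ⟨z, rfl, h⟩
    exact ⟨h, fun i => ⟨z i, rfl⟩⟩

lemma inter_latticeBall_eq {n : ℕ} (r : ℝ) (H : Submodule ℝ (EuclideanSpace ℝ (Fin n))) :
    (H : Set (EuclideanSpace ℝ (Fin n))) ∩ latticeBall n r =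
      intVec '' (sectionPoints r H : Set (Fin n → ℤ)) := by
  ext x
  simp only [Set.mem_inter_iff, SetLike.mem_coe, mem_latticeBall_iff, Set.mem_image,
    mem_sectionPoints]
  constructor
  · rintro ⟨hx, z, rfl, hz⟩
    exact ⟨z, ⟨hx, hz⟩, rfl⟩
  · rintro ⟨z, ⟨hx, hz⟩, rfl⟩
    exact ⟨hx, z, rfl, hz⟩

lemma ncard_inter_latticeBall {n : ℕ} (r : ℝ) (H : Submodule ℝ (EuclideanSpace ℝ (Fin n))) :
    ((H : Set (EuclideanSpace ℝ (Fin n))) ∩ latticeBall n r).ncard = (sectionPoints r H).card := by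
  rw [inter_latticeBall_eq, Set.ncard_image_of_injective _ intVec_injective, Set.ncard_coe_finset]

lemma latticeBall_finite (n : ℕ) (r : ℝ) : (latticeBall n r).Finite := by
  have := inter_latticeBall_eq r (⊤ : Submodule ℝ (EuclideanSpace ℝ (Fin n)))
  rw [Submodule.top_coe, Set.univ_inter] at this
  rw [this]
  exact (Finset.finite_toSet _).image _

/-- The linear span of a family of integer vectors. -/
noncomputable def intSpan {n m : ℕ} (V : Fin m → Fin n → ℤ) :
    Submodule ℝ (EuclideanSpace ℝ (Fin n)) :=
  Submodule.span ℝ (Set.range fun k => intVec (V k))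

lemma intVec_mem_intSpan {n m : ℕ} (V : Fin m → Fin n → ℤ) (k : Fin m) :
    intVec (V k) ∈ intSpan V :=
  Submodule.subset_span ⟨k, rfl⟩

lemma mem_latticeHyperplanes_iff {m : ℕ} {r : ℝ}
    {H : Submodule ℝ (EuclideanSpace ℝ (Fin (m + 1)))} :
    H ∈ latticeHyperplanes (m + 1) r ↔ ∃ V : Fin m → Fin (m + 1) → ℤ,
      LinearIndependent ℝ (fun k => intVec (V k)) ∧ (∀ k, ‖intVec (V k)‖ ≤ r) ∧ intSpan V = H := by
  constructor
  · rintro ⟨hH, v, hv, hvH⟩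
    change Module.finrank ℝ H = m at hH
    change Fin m → _ at v
    have hz : ∀ k : Fin m, ∃ z, intVec z = v k ∧ ‖intVec z‖ ≤ r := fun k =>
      mem_latticeBall_iff.1 (hvH k).2
    choose V hV hVr using hz
    have hVv : (fun k => intVec (V k)) = v := funext hV
    refine ⟨V, by rw [hVv]; exact hv, hVr, ?_⟩
    refine Submodule.eq_of_le_of_finrank_eq ?_ ?_
    · rw [intSpan, Submodule.span_le, hVv]
      rintro _ ⟨k, rfl⟩
      exact (hvH k).1
    · rw [intSpan, hVv, finrank_span_eq_card hv, hH]
      exact Fintype.card_fin m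
  · rintro ⟨V, hV, hVr, rfl⟩
    refine ⟨?_, fun k => intVec (V k), hV, fun k =>
      ⟨intVec_mem_intSpan V k, mem_latticeBall_iff.2 ⟨V k, rfl, hVr k⟩⟩⟩
    rw [intSpan, finrank_span_eq_card hV]
    simp

lemma latticeHyperplanes_finite (m : ℕ) (r : ℝ) : (latticeHyperplanes (m + 1) r).Finite := by
  refine ((Finset.finite_toSet (Fintype.piFinset
    fun _ : Fin m => sectionPoints r ⊤)).image intSpan).subset ?_
  intro H hH
  obtain ⟨V, -, hVr, rfl⟩ := mem_latticeHyperplanes_iff.1 hH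
  exact ⟨V, by simpa [mem_sectionPoints] using hVr, rfl⟩

/-! ### Primitive normal vectors -/

/-- The linear form on `ℝⁿ` whose coefficients are the integers `a`. -/
noncomputable def intForm {n : ℕ} (a : Fin n → ℤ) : EuclideanSpace ℝ (Fin n) →ₗ[ℝ] ℝ where
  toFun x := ∑ i, (a i : ℝ) * x i
  map_add' x y := by simp [mul_add, Finset.sum_add_distrib]
  map_smul' c x := by
    simp only [PiLp.smul_apply, smul_eq_mul, RingHom.id_apply, Finset.mul_sum]
    exact Finset.sum_congr rfl fun i _ => by ring

lemma intForm_apply {n : ℕ} (a : Fin n → ℤ) (x : EuclideanSpace ℝ (Fin n)) :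
    intForm a x = ∑ i, (a i : ℝ) * x i := rfl

lemma intForm_intVec {n : ℕ} (a z : Fin n → ℤ) : intForm a (intVec z) = ((a ⬝ᵥ z : ℤ) : ℝ) := by
  simp [intForm_apply, dotProduct]

/-- Over `ℤ`, a homogeneous system of `m` equations in `m + 1` unknowns has a solution that is
nonzero, and dividing by the greatest common divisor of its entries makes it primitive. -/
lemma exists_primitive_orthogonal {m : ℕ} (V : Fin m → Fin (m + 1) → ℤ) :
    ∃ a : Fin (m + 1) → ℤ, (∃ y, a ⬝ᵥ y = 1) ∧ ∀ k, a ⬝ᵥ V k = 0 := by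
  obtain ⟨b, hb, hb0⟩ : ∃ b : Fin (m + 1) → ℤ, b ≠ 0 ∧ ∀ k, b ⬝ᵥ V k = 0 := by
    by_contra! hcon
    have hinj : Function.Injective (Matrix.mulVecLin (Matrix.of V)) := by
      rw [injective_iff_map_eq_zero]
      intro b hb
      by_contra hb0
      obtain ⟨k, hk⟩ := hcon b hb0
      apply hk
      have := congrFun hb k
      rw [dotProduct_comm]
      exact this
    have := card_le_of_injective ℤ _ hinj
    simp at this
  obtain ⟨a, hba, ha⟩ := Finset.extract_gcd b (Finset.univ_nonempty (α := Fin (m + 1)))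
  obtain ⟨y, hy⟩ := Finset.gcd_eq_sum_mul Finset.univ a
  have hg : Finset.univ.gcd b ≠ 0 := by
    intro hg
    apply hb
    funext i
    simpa [hg] using hba i (Finset.mem_univ i)
  refine ⟨a, ⟨y, by rw [dotProduct, ← hy, ha]⟩, fun k => ?_⟩
  have h : Finset.univ.gcd b * (a ⬝ᵥ V k) = 0 := by
    rw [← hb0 k, dotProduct, dotProduct, Finset.mul_sum]
    refine Finset.sum_congr rfl fun i hi => ?_
    rw [hba i hi]
    ring
  exact (mul_eq_zero.1 h).resolve_left hg

/-- A hyperplane spanned by integer vectors is the kernel of an integer form that takes the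
value `1`. -/
lemma exists_primitive_normal {m : ℕ} {r : ℝ}
    {H : Submodule ℝ (EuclideanSpace ℝ (Fin (m + 1)))} (hH : H ∈ latticeHyperplanes (m + 1) r) :
    ∃ a : Fin (m + 1) → ℤ, (∃ y, a ⬝ᵥ y = 1) ∧ H = LinearMap.ker (intForm a) := by
  obtain ⟨V, hV, -, rfl⟩ := mem_latticeHyperplanes_iff.1 hH
  obtain ⟨a, ⟨y, hy⟩, ha⟩ := exists_primitive_orthogonal V
  refine ⟨a, ⟨y, hy⟩, Submodule.eq_of_le_of_finrank_eq ?_ ?_⟩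
  · rw [intSpan, Submodule.span_le]
    rintro _ ⟨k, rfl⟩
    simp [intForm_intVec, ha]
  · have hne : intForm a ≠ 0 := by
      intro h
      have := intForm_intVec a y
      rw [h, hy] at this
      simp at this
    have := Module.Dual.finrank_ker_add_one_of_ne_zero hne
    rw [finrank_euclideanSpace_fin] at this
    rw [intSpan, finrank_span_eq_card hV, Fintype.card_fin]
    omega

/-! ### Lattice points of a hyperplane against the size of its normal vector -/

/-- Every level `a ⬝ᵥ y = j` with `|j| ≤ |a i₀| * r` has an integer point of size `O(r)`: some
integer point exists since `a` is primitive, and reducing it modulo a basis of the hyperplane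
brings it close to the real point `(j / a i₀) e_{i₀}` of the same level. -/
lemma exists_small_lattice_point_on_level {m : ℕ} {r : ℝ} (hr : 0 ≤ r)
    {a : Fin (m + 1) → ℤ} (ha : ∃ y, a ⬝ᵥ y = 1)
    (hH : LinearMap.ker (intForm a) ∈ latticeHyperplanes (m + 1) r) (i₀ : Fin (m + 1))
    (hi₀ : a i₀ ≠ 0) (j : ℤ) (hj : |(j : ℝ)| ≤ |(a i₀ : ℝ)| * r) :
    ∃ y, a ⬝ᵥ y = j ∧ ∀ i, |(y i : ℝ)| ≤ (m + 1) * r := by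
  obtain ⟨y₁, hy₁⟩ := ha
  obtain ⟨V, -, hVr, hVH⟩ := mem_latticeHyperplanes_iff.1 hH
  have haR : (a i₀ : ℝ) ≠ 0 := by exact_mod_cast hi₀
  have haV : ∀ k, a ⬝ᵥ V k = 0 := by
    intro k
    have h : intForm a (intVec (V k)) = 0 := LinearMap.mem_ker.1 (hVH ▸ intVec_mem_intSpan V k)
    rw [intForm_intVec] at h
    exact_mod_cast h
  have hmem : intVec (j • y₁) - EuclideanSpace.single i₀ ((j : ℝ) / a i₀) ∈ intSpan V := by
    rw [hVH, LinearMap.mem_ker, map_sub, intForm_intVec, dotProduct_smul, hy₁, intForm_apply]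
    simp only [smul_eq_mul, mul_one, PiLp.single_apply, mul_ite, mul_zero, Finset.sum_ite_eq',
      Finset.mem_univ, if_true]
    field_simp
    ring
  obtain ⟨t, ht⟩ := (Submodule.mem_span_range_iff_exists_fun ℝ).1 hmem
  refine ⟨j • y₁ - ∑ k, ⌊t k⌋ • V k, ?_, fun i => ?_⟩
  · simp only [dotProduct_sub, dotProduct_sum, dotProduct_smul, haV, hy₁, smul_eq_mul, mul_one,
      mul_zero, Finset.sum_const_zero, sub_zero]
  · have hcoord := congrArg (fun x : EuclideanSpace ℝ (Fin (m + 1)) => x i) ht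
    simp only [WithLp.ofLp_sum, Finset.sum_apply, PiLp.smul_apply, PiLp.sub_apply, smul_eq_mul,
      intVec_apply, Pi.smul_apply] at hcoord
    have hy : (((j • y₁ - ∑ k, ⌊t k⌋ • V k : Fin (m + 1) → ℤ) i : ℤ) : ℝ) =
        EuclideanSpace.single i₀ ((j : ℝ) / a i₀) i + ∑ k, Int.fract (t k) * (V k i : ℝ) := by
      simp only [Int.fract, sub_mul, Finset.sum_sub_distrib, hcoord]
      simp
      ring
    have hsingle : |EuclideanSpace.single i₀ ((j : ℝ) / a i₀) i| ≤ r := by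
      rw [PiLp.single_apply]
      split_ifs
      · rw [abs_div, div_le_iff₀ (abs_pos.2 haR), mul_comm]
        exact hj
      · simpa using hr
    have hterm : ∀ k, |Int.fract (t k) * (V k i : ℝ)| ≤ r := by
      intro k
      have h1 : |(V k i : ℝ)| ≤ r := by
        have := PiLp.norm_apply_le (intVec (V k)) i
        simp only [intVec_apply, Real.norm_eq_abs] at this
        exact this.trans (hVr k)
      rw [abs_mul, abs_of_nonneg (Int.fract_nonneg _)]
      calc Int.fract (t k) * |(V k i : ℝ)| ≤ 1 * |(V k i : ℝ)| := by
            gcongr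
            exact (Int.fract_lt_one _).le
        _ ≤ r := by rw [one_mul]; exact h1
    rw [hy]
    calc _ ≤ |EuclideanSpace.single i₀ ((j : ℝ) / a i₀) i|
          + ∑ k, |Int.fract (t k) * (V k i : ℝ)| :=
        (abs_add_le _ _).trans (by gcongr; exact Finset.abs_sum_le_sum_abs _ _)
      _ ≤ r + ∑ _k : Fin m, r := by gcongr with k; exact hterm k
      _ = (m + 1) * r := by simp; ring

/-- A hyperplane with primitive normal vector `a` that is spanned by lattice points of size `r` has
`O(r ^ m / |a i₀|)` of them. The levels `a ⬝ᵥ y = j` with `|j| ≤ |a i₀| * r` contain disjoint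
translates of the set of these lattice points, all lying in one box of side `O(r)`. -/
lemma abs_normal_mul_card_sectionPoints_le {m : ℕ} {r : ℝ} (hr : 1 ≤ r)
    {a : Fin (m + 1) → ℤ} (ha : ∃ y, a ⬝ᵥ y = 1)
    (hH : LinearMap.ker (intForm a) ∈ latticeHyperplanes (m + 1) r) (i₀ : Fin (m + 1)) :
    |(a i₀ : ℝ)| * (sectionPoints r (LinearMap.ker (intForm a))).card ≤
      (2 * (m : ℝ) + 5) ^ (m + 1) * r ^ m := by
  have hr0 : 0 < r := by linarith
  by_cases hi₀ : a i₀ = 0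
  · rw [hi₀]; simp; positivity
  set S := sectionPoints r (LinearMap.ker (intForm a)) with hS
  set J : ℤ := ⌊|(a i₀ : ℝ)| * r⌋ with hJ
  have hlevel : ∀ j : ℤ, ∃ y : Fin (m + 1) → ℤ, j ∈ Finset.Icc (-J) J →
      a ⬝ᵥ y = j ∧ ∀ i, |(y i : ℝ)| ≤ (m + 1) * r := by
    intro j
    by_cases hj : j ∈ Finset.Icc (-J) J
    · rw [Finset.mem_Icc, ← abs_le, hJ, Int.le_floor, Int.cast_abs] at hj
      obtain ⟨y, hy⟩ := exists_small_lattice_point_on_level hr0.le ha hH i₀ hi₀ j hj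
      exact ⟨y, fun _ => hy⟩
    · exact ⟨0, fun h => absurd h hj⟩
  choose y hy using hlevel
  have hSa : ∀ z ∈ S, a ⬝ᵥ z = 0 := by
    intro z hz
    have h : intForm a (intVec z) = 0 := LinearMap.mem_ker.1 (mem_sectionPoints.1 hz).1
    rw [intForm_intVec] at h
    exact_mod_cast h
  have hcard : (Finset.Icc (-J) J ×ˢ S).card ≤ (intBox (m + 1) ((m + 2) * r)).card := by
    refine Finset.card_le_card_of_injOn (fun p => y p.1 + p.2) ?_ ?_
    · rintro ⟨j, z⟩ hp
      obtain ⟨hj, hz⟩ := Finset.mem_product.1 (Finset.mem_coe.1 hp)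
      rw [Finset.mem_coe, mem_intBox]
      intro i
      have h1 := (hy j hj).2 i
      have h2 := mem_intBox.1 (sectionPoints_subset_intBox _ _ hz) i
      have h3 := abs_add_le (y j i : ℝ) (z i : ℝ)
      simp only [Pi.add_apply, Int.cast_add]
      linarith
    · rintro ⟨j, z⟩ hp ⟨j', z'⟩ hp' h
      obtain ⟨hj, hz⟩ := Finset.mem_product.1 (Finset.mem_coe.1 hp)
      obtain ⟨hj', hz'⟩ := Finset.mem_product.1 (Finset.mem_coe.1 hp')
      simp only at h hj hz hj' hz'
      have hjj : j = j' := by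
        have := congrArg (a ⬝ᵥ ·) h
        simpa [dotProduct_add, hSa z hz, hSa z' hz', (hy j hj).1, (hy j' hj').1] using this
      subst hjj
      simpa using h
  rw [Finset.card_product] at hcard
  have hJ0 : 0 ≤ J := Int.floor_nonneg.2 (by positivity)
  have hIcc : |(a i₀ : ℝ)| * r ≤ (Finset.Icc (-J) J).card := by
    have h1 : ((Finset.Icc (-J) J).card : ℤ) = 2 * J + 1 := by
      rw [Int.card_Icc, Int.toNat_of_nonneg (by omega)]; ring
    have h2 : ((Finset.Icc (-J) J).card : ℝ) = 2 * J + 1 := by exact_mod_cast h1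
    have h3 : (0 : ℝ) ≤ J := by exact_mod_cast hJ0
    have h4 := Int.lt_floor_add_one (|(a i₀ : ℝ)| * r)
    rw [h2]
    linarith
  have hbox : ((intBox (m + 1) ((m + 2) * r)).card : ℝ) ≤ ((2 * (m : ℝ) + 5) * r) ^ (m + 1) := by
    refine (card_intBox_le (by positivity)).trans ?_
    gcongr
    linarith
  have hmain : (|(a i₀ : ℝ)| * S.card) * r ≤ ((2 * (m : ℝ) + 5) ^ (m + 1) * r ^ m) * r := by
    calc (|(a i₀ : ℝ)| * S.card) * r = (|(a i₀ : ℝ)| * r) * S.card := by ring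
      _ ≤ (Finset.Icc (-J) J).card * (S.card : ℝ) := by gcongr
      _ ≤ (intBox (m + 1) ((m + 2) * r)).card := by exact_mod_cast hcard
      _ ≤ ((2 * (m : ℝ) + 5) * r) ^ (m + 1) := hbox
      _ = _ := by rw [mul_pow]; ring
  exact le_of_mul_le_mul_right hmain hr0

/-! ### The sum of the section sizes from above -/

/-- Steinitz exchange: a nonzero lattice point of a hyperplane can replace a suitable member of a
family of lattice points spanning the hyperplane. -/
lemma exists_spanning_family_with_entry {m : ℕ} {r : ℝ}
    {H : Submodule ℝ (EuclideanSpace ℝ (Fin (m + 1)))} (hH : H ∈ latticeHyperplanes (m + 1) r)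
    {x : Fin (m + 1) → ℤ} (hx : x ∈ sectionPoints r H) (hx0 : x ≠ 0) :
    ∃ (i : Fin m) (V : Fin m → Fin (m + 1) → ℤ),
      (∀ k, V k ∈ sectionPoints r ⊤) ∧ intSpan V = H ∧ V i = x := by
  obtain ⟨V, -, hVr, rfl⟩ := mem_latticeHyperplanes_iff.1 hH
  obtain ⟨hxH, hxr⟩ := mem_sectionPoints.1 hx
  obtain ⟨t, ht⟩ := (Submodule.mem_span_range_iff_exists_fun ℝ).1 hxH
  obtain ⟨i, hi⟩ : ∃ i, t i ≠ 0 := by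
    by_contra! h
    apply hx0
    apply intVec_injective
    rw [← ht]
    ext i
    simp [h]
  refine ⟨i, Function.update V i x, fun k => ?_, ?_, Function.update_self ..⟩
  · rcases eq_or_ne k i with rfl | hk
    · simpa [mem_sectionPoints] using hxr
    · simpa [mem_sectionPoints, hk] using hVr k
  have hother : ∀ k, k ≠ i → intVec (V k) ∈ intSpan (Function.update V i x) := by
    intro k hk
    have := intVec_mem_intSpan (Function.update V i x) k
    rwa [Function.update_of_ne hk] at this
  apply le_antisymm
  · refine Submodule.span_le.2 ?_
    rintro _ ⟨k, rfl⟩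
    rcases eq_or_ne k i with rfl | hk
    · simpa using hxH
    · simpa [hk] using intVec_mem_intSpan V k
  · refine Submodule.span_le.2 ?_
    rintro _ ⟨k, rfl⟩
    rcases eq_or_ne k i with rfl | hk
    · have hxm := intVec_mem_intSpan (Function.update V k x) k
      rw [Function.update_self, ← ht, ← Finset.add_sum_erase _ _ (Finset.mem_univ k)] at hxm
      have hsum : ∑ l ∈ Finset.univ.erase k, t l • intVec (V l) ∈
          intSpan (Function.update V k x) :=
        Submodule.sum_mem _ fun l hl =>
          Submodule.smul_mem _ _ (hother l (Finset.ne_of_mem_erase hl))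
      exact (Submodule.smul_mem_iff _ hi).1 ((Submodule.add_mem_iff_left _ hsum).1 hxm)
    · exact hother k hk

/-- The incidences of nonzero lattice points with hyperplanes inject into the pairs of an index and
a family of `m` lattice points. -/
lemma sum_card_sectionPoints_le (m : ℕ) {r : ℝ} (hr : 1 ≤ r) :
    ∑ H ∈ (latticeHyperplanes_finite m r).toFinset, ((sectionPoints r H).card : ℝ) ≤
      (latticeHyperplanes_finite m r).toFinset.card + m * (3 * r) ^ ((m + 1) * m) := by
  classical
  set T : Finset (Fin m × (Fin m → Fin (m + 1) → ℤ)) :=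
    Finset.univ ×ˢ Fintype.piFinset fun _ => sectionPoints r ⊤ with hT
  have hfib : ∀ H ∈ (latticeHyperplanes_finite m r).toFinset,
      (sectionPoints r H).card ≤ 1 + (T.filter fun p => intSpan p.2 = H).card := by
    intro H hH
    rw [Set.Finite.mem_toFinset] at hH
    have h1 : ((sectionPoints r H).erase 0).card ≤ (T.filter fun p => intSpan p.2 = H).card := by
      refine Finset.card_le_card_of_surjOn (fun p => p.2 p.1) ?_
      intro x hx
      obtain ⟨hx0, hx⟩ := Finset.mem_erase.1 (Finset.mem_coe.1 hx)
      obtain ⟨i, V, hV, hVH, hVi⟩ := exists_spanning_family_with_entry hH hx hx0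
      exact ⟨(i, V), by simpa [hT, hVH] using hV, hVi⟩
    have h2 := Finset.pred_card_le_card_erase (s := sectionPoints r H) (a := 0)
    omega
  have hsum : ∑ H ∈ (latticeHyperplanes_finite m r).toFinset, (sectionPoints r H).card ≤
      (latticeHyperplanes_finite m r).toFinset.card + T.card := by
    calc _ ≤ ∑ H ∈ (latticeHyperplanes_finite m r).toFinset,
          (1 + (T.filter fun p => intSpan p.2 = H).card) := Finset.sum_le_sum hfib
      _ ≤ _ := by
        rw [Finset.sum_add_distrib, Finset.sum_const, smul_eq_mul, mul_one]
        gcongr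
        rw [Finset.sum_card_fiberwise_eq_card_filter]
        exact Finset.card_filter_le _ _
  have hTcard : (T.card : ℝ) ≤ m * (3 * r) ^ ((m + 1) * m) := by
    have h1 : ((sectionPoints r (⊤ : Submodule ℝ (EuclideanSpace ℝ (Fin (m + 1))))).card : ℝ) ≤
        (3 * r) ^ (m + 1) := by
      calc _ ≤ ((intBox (m + 1) r).card : ℝ) := by
            exact_mod_cast Finset.card_le_card (sectionPoints_subset_intBox _ _)
        _ ≤ (2 * r + 1) ^ (m + 1) := card_intBox_le (by linarith)
        _ ≤ _ := by gcongr; linarith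
    rw [hT, Finset.card_product, Fintype.card_piFinset]
    simp only [Finset.card_univ, Fintype.card_fin, Finset.prod_const, Nat.cast_mul, Nat.cast_pow]
    rw [pow_mul]
    gcongr
  calc _ ≤ ((latticeHyperplanes_finite m r).toFinset.card : ℝ) + T.card := by exact_mod_cast hsum
    _ ≤ _ := by gcongr

/-! ### Many independent families of lattice points -/

/-- The family of vectors `e_k + 2 u_k`, for `k < m`. It is congruent to the first `m` unit vectors
modulo `2`, hence linearly independent. -/
def oddFamily {m : ℕ} (u : Fin m → Fin (m + 1) → ℤ) (k : Fin m) : Fin (m + 1) → ℤ :=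
  Pi.single k.castSucc 1 + 2 • u k

lemma oddFamily_injective {m : ℕ} : Function.Injective (oddFamily (m := m)) := by
  intro u w h
  funext k i
  have := congrFun (congrFun h k) i
  simpa [oddFamily] using this

lemma linearIndependent_oddFamily {m : ℕ} (u : Fin m → Fin (m + 1) → ℤ) :
    LinearIndependent ℝ fun k => intVec (oddFamily u k) := by
  set U : Matrix (Fin m) (Fin m) ℤ := Matrix.of fun k l => u k l.castSucc with hU
  have hdet : (1 + 2 • U).det ≠ 0 := by
    intro h
    have h2 := RingHom.map_det (Int.castRingHom (ZMod 2)) (1 + 2 • U)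
    have h3 : (Int.castRingHom (ZMod 2)).mapMatrix (1 + 2 • U) = 1 := by
      rw [map_add, map_one, map_nsmul, add_eq_left]
      ext k l
      simp only [Matrix.smul_apply, Matrix.zero_apply, nsmul_eq_mul]
      rw [show ((2 : ℕ) : ZMod 2) = 0 from rfl, zero_mul]
    rw [h, h3, Matrix.det_one, map_zero] at h2
    exact zero_ne_one h2
  have hunit : IsUnit ((Int.castRingHom ℝ).mapMatrix (1 + 2 • U)) := by
    rw [Matrix.isUnit_iff_isUnit_det, ← RingHom.map_det, isUnit_iff_ne_zero]
    simpa using hdet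
  have hrow := Matrix.linearIndependent_rows_iff_isUnit.2 hunit
  refine LinearIndependent.of_comp
    (LinearMap.pi fun l : Fin m => (EuclideanSpace.proj l.castSucc :
      EuclideanSpace ℝ (Fin (m + 1)) →L[ℝ] ℝ).toLinearMap) ?_
  have heq : (⇑(LinearMap.pi fun l : Fin m => (EuclideanSpace.proj l.castSucc :
      EuclideanSpace ℝ (Fin (m + 1)) →L[ℝ] ℝ).toLinearMap) ∘ fun k => intVec (oddFamily u k)) =
      ((Int.castRingHom ℝ).mapMatrix (1 + 2 • U)).row := by
    funext k l
    simp [oddFamily, hU, Matrix.one_apply, Pi.single_apply, eq_comm]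
  rw [heq]
  exact hrow

lemma norm_intVec_oddFamily_le {m : ℕ} {r : ℝ} (hr : 1 ≤ r) {u : Fin m → Fin (m + 1) → ℤ}
    (k : Fin m) (hu : u k ∈ intBox (m + 1) (r / (4 * (m + 1)))) :
    ‖intVec (oddFamily u k)‖ ≤ r := by
  rw [mem_intBox] at hu
  -- For `r < 4 * (m + 1)` the box contains only the origin, and the vector is a unit vector.
  rcases lt_or_ge r (4 * (m + 1)) with h | h
  · have h0 : u k = 0 := by
      funext i
      have h1 : |(u k i : ℝ)| < 1 := (hu i).trans_lt ((div_lt_one (by positivity)).2 h)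
      have h2 : |u k i| < 1 := by exact_mod_cast h1
      exact Int.abs_lt_one_iff.1 h2
    have h1 : intVec (oddFamily u k) = EuclideanSpace.single k.castSucc (1 : ℝ) := by
      ext i
      simp [oddFamily, h0, Pi.single_apply]
    rw [h1]
    simpa using hr
  · set q : ℝ := r / (4 * (m + 1)) with hq
    have hq1 : 1 ≤ q := (one_le_div (by positivity)).2 h
    have hqr : (4 * (m + 1)) * q = r := by rw [hq]; field_simp
    have hcoord : ∀ i, |(oddFamily u k i : ℝ)| ≤ 3 * q := by
      intro i
      have h1 : |((Pi.single k.castSucc 1 : Fin (m + 1) → ℤ) i : ℝ)| ≤ 1 := by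
        rw [Pi.single_apply]
        split_ifs <;> simp
      have h2 := hu i
      have h3 : (oddFamily u k i : ℝ) =
          ((Pi.single k.castSucc 1 : Fin (m + 1) → ℤ) i : ℝ) + 2 * u k i := by
        simp [oddFamily]
      rw [h3]
      refine (abs_add_le _ _).trans ?_
      rw [abs_mul, abs_two]
      linarith
    rw [EuclideanSpace.norm_eq, Real.sqrt_le_left (by linarith)]
    calc ∑ i, ‖intVec (oddFamily u k) i‖ ^ 2 ≤ ∑ _i : Fin (m + 1), (3 * q) ^ 2 := by
          gcongr with i
          exact hcoord i
      _ = (m + 1) * (3 * q) ^ 2 := by simp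
      _ ≤ ((m + 1) * (m + 1)) * (4 * q) ^ 2 := by
          gcongr
          · nlinarith
          · linarith
      _ = r ^ 2 := by rw [← hqr]; ring

/-- The parameters of the families `oddFamily u` that consist of points of the ball of
radius `r`. -/
noncomputable def oddParameters (m : ℕ) (r : ℝ) : Finset (Fin m → Fin (m + 1) → ℤ) :=
  Fintype.piFinset fun _ => intBox (m + 1) (r / (4 * (m + 1)))

lemma norm_oddFamily_of_mem {m : ℕ} {r : ℝ} (hr : 1 ≤ r) {u : Fin m → Fin (m + 1) → ℤ}
    (hu : u ∈ oddParameters m r) (k : Fin m) : ‖intVec (oddFamily u k)‖ ≤ r :=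
  norm_intVec_oddFamily_le hr k (Fintype.mem_piFinset.1 hu k)

lemma intSpan_oddFamily_mem {m : ℕ} {r : ℝ} (hr : 1 ≤ r) {u : Fin m → Fin (m + 1) → ℤ}
    (hu : u ∈ oddParameters m r) : intSpan (oddFamily u) ∈ latticeHyperplanes (m + 1) r :=
  mem_latticeHyperplanes_iff.2
    ⟨oddFamily u, linearIndependent_oddFamily u, norm_oddFamily_of_mem hr hu, rfl⟩

lemma le_card_oddParameters (m : ℕ) {r : ℝ} (hr : 1 ≤ r) :
    (1 / (4 * (m + 1) : ℝ)) ^ ((m + 1) * m) * r ^ ((m + 1) * m) ≤ (oddParameters m r).card := by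
  rw [← mul_pow, pow_mul, one_div_mul_eq_div]
  simp only [oddParameters, Fintype.card_piFinset, Finset.prod_const, Finset.card_univ,
    Fintype.card_fin, Nat.cast_pow]
  gcongr
  exact pow_le_card_intBox (by positivity)

lemma card_oddParameters_fiber_le {m : ℕ} {r : ℝ} (hr : 1 ≤ r)
    (H : Submodule ℝ (EuclideanSpace ℝ (Fin (m + 1))))
    (s : Finset (Fin m → Fin (m + 1) → ℤ)) (hs : s ⊆ oddParameters m r)
    (hsH : ∀ u ∈ s, intSpan (oddFamily u) = H) : s.card ≤ (sectionPoints r H).card ^ m := by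
  have h : s.card ≤ (Fintype.piFinset fun _ : Fin m => sectionPoints r H).card := by
    refine Finset.card_le_card_of_injOn oddFamily ?_ oddFamily_injective.injOn
    intro u hu
    rw [Finset.mem_coe, Fintype.mem_piFinset]
    intro k
    exact mem_sectionPoints.2
      ⟨hsH u hu ▸ intVec_mem_intSpan _ k, norm_oddFamily_of_mem hr (hs hu) k⟩
  simpa using h

/-! ### Few families with a short normal vector -/

/-- The integer vectors whose entry at `i₀` is `c` and whose other entries are at most `|c|` in
absolute value. -/
noncomputable def intShell {n : ℕ} (i₀ : Fin n) (c : ℤ) : Finset (Fin n → ℤ) :=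
  Fintype.piFinset fun i => if i = i₀ then {c} else Finset.Icc (-|c|) |c|

lemma mem_intShell {n : ℕ} {i₀ : Fin n} {c : ℤ} {a : Fin n → ℤ} (ha : a i₀ = c)
    (hmax : ∀ i, |a i| ≤ |c|) : a ∈ intShell i₀ c := by
  rw [intShell, Fintype.mem_piFinset]
  intro i
  split_ifs with h
  · simp [h, ha]
  · exact Finset.mem_Icc.2 (abs_le.1 (hmax i))

lemma apply_of_mem_intShell {n : ℕ} {i₀ : Fin n} {c : ℤ} {a : Fin n → ℤ}
    (ha : a ∈ intShell i₀ c) : a i₀ = c := by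
  simpa using Fintype.mem_piFinset.1 ha i₀

lemma card_intShell_le {m : ℕ} (i₀ : Fin (m + 1)) {c : ℤ} (hc : c ≠ 0) :
    ((intShell i₀ c).card : ℝ) ≤ (3 * |(c : ℝ)|) ^ m := by
  have h1 : ((Finset.Icc (-|c|) |c|).card : ℤ) = 2 * |c| + 1 := by
    rw [Int.card_Icc, Int.toNat_of_nonneg (by have := abs_nonneg c; omega)]; ring
  have h2 : ((Finset.Icc (-|c|) |c|).card : ℝ) = 2 * |(c : ℝ)| + 1 := by exact_mod_cast h1
  have h3 : (1 : ℝ) ≤ |(c : ℝ)| := by exact_mod_cast Int.one_le_abs hc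
  have h4 : (intShell i₀ c).card = (Finset.Icc (-|c|) |c|).card ^ m := by
    rw [intShell, Fintype.card_piFinset, ← Finset.mul_prod_erase _ _ (Finset.mem_univ i₀),
      Finset.prod_congr rfl (g := fun _ => (Finset.Icc (-|c|) |c|).card)
        (fun i hi => by rw [if_neg (Finset.ne_of_mem_erase hi)])]
    simp
  rw [h4, Nat.cast_pow, h2]
  gcongr
  linarith

open Classical in
/-- The parameters `u` for which the span of `oddFamily u` is the hyperplane with primitive normal
vector `a`. -/
noncomputable def parametersWithNormal {m : ℕ} (r : ℝ) (a : Fin (m + 1) → ℤ) :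
    Finset (Fin m → Fin (m + 1) → ℤ) :=
  (oddParameters m r).filter fun u =>
    (∃ y, a ⬝ᵥ y = 1) ∧ intSpan (oddFamily u) = LinearMap.ker (intForm a)

lemma card_parametersWithNormal_le {m : ℕ} {r : ℝ} (hr : 1 ≤ r) {a : Fin (m + 1) → ℤ}
    (i₀ : Fin (m + 1)) (hi₀ : a i₀ ≠ 0) :
    ((parametersWithNormal r a).card : ℝ) ≤
      ((2 * (m : ℝ) + 5) ^ (m + 1) * r ^ m / |(a i₀ : ℝ)|) ^ m := by
  classical
  rcases (parametersWithNormal r a).eq_empty_or_nonempty with h | ⟨u, hu⟩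
  · rw [h, Finset.card_empty, Nat.cast_zero]
    positivity
  · obtain ⟨hu1, ha, hua⟩ := Finset.mem_filter.1 hu
    have h1 := card_oddParameters_fiber_le hr (LinearMap.ker (intForm a)) (parametersWithNormal r a)
      (Finset.filter_subset _ _) fun w hw => (Finset.mem_filter.1 hw).2.2
    have h2 := abs_normal_mul_card_sectionPoints_le hr ha (hua ▸ intSpan_oddFamily_mem hr hu1) i₀
    have h3 : (0 : ℝ) < |(a i₀ : ℝ)| := abs_pos.2 (by exact_mod_cast hi₀)
    calc ((parametersWithNormal r a).card : ℝ)
        ≤ ((sectionPoints r (LinearMap.ker (intForm a))).card : ℝ) ^ m := by exact_mod_cast h1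
      _ ≤ _ := by
        gcongr
        rw [le_div_iff₀ h3, mul_comm]
        exact h2

open Classical in
/-- The parameters `u` for which the span of `oddFamily u` has a primitive normal vector with all
entries at most `X` in absolute value. -/
noncomputable def shortNormalParameters (m : ℕ) (r X : ℝ) : Finset (Fin m → Fin (m + 1) → ℤ) :=
  (oddParameters m r).filter fun u => ∃ a : Fin (m + 1) → ℤ, (∃ y, a ⬝ᵥ y = 1) ∧
    intSpan (oddFamily u) = LinearMap.ker (intForm a) ∧ ∀ i, |(a i : ℝ)| ≤ X

/-- The normal vectors whose largest entry is `c`, at position `i₀`, number `O(|c| ^ m)`, and each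
of them accounts for `O((r ^ m / |c|) ^ m)` parameters. The powers of `|c|` cancel, so every pair
`(i₀, c)` contributes the same amount. -/
lemma card_shortNormalParameters_le (m : ℕ) {r X : ℝ} (hr : 1 ≤ r) (hX : 0 ≤ X) :
    ((shortNormalParameters m r X).card : ℝ) ≤
      2 * (m + 1) * X * (3 * (2 * (m : ℝ) + 5) ^ (m + 1) * r ^ m) ^ m := by
  classical
  set K : ℤ := ⌊X⌋ with hK
  have hK0 : 0 ≤ K := Int.floor_nonneg.2 hX
  set I : Finset (Fin (m + 1) × ℤ) := Finset.univ ×ˢ (Finset.Icc (-K) K).erase 0 with hI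
  have hsub : shortNormalParameters m r X ⊆
      I.biUnion fun p => (intShell p.1 p.2).biUnion fun a => parametersWithNormal r a := by
    intro u hu
    obtain ⟨hu1, a, ha, hua, haX⟩ := Finset.mem_filter.1 hu
    obtain ⟨i₀, -, hmax⟩ := Finset.exists_max_image Finset.univ (fun i => |a i|)
      Finset.univ_nonempty
    have hai : a i₀ ≠ 0 := by
      intro h0
      obtain ⟨y, hy⟩ := ha
      have : a = 0 := by
        funext i
        have := hmax i (Finset.mem_univ i)
        rw [h0, abs_zero] at this
        exact abs_nonpos_iff.1 this
      rw [this, zero_dotProduct] at hy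
      exact zero_ne_one hy
    refine Finset.mem_biUnion.2 ⟨(i₀, a i₀), ?_, Finset.mem_biUnion.2
      ⟨a, mem_intShell rfl fun i => hmax i (Finset.mem_univ i), Finset.mem_filter.2 ⟨hu1, ha, hua⟩⟩⟩
    refine Finset.mem_product.2 ⟨Finset.mem_univ _, Finset.mem_erase.2 ⟨hai, ?_⟩⟩
    rw [Finset.mem_Icc, ← abs_le, hK, Int.le_floor, Int.cast_abs]
    exact haX i₀
  have hterm : ∀ p ∈ I, ((((intShell p.1 p.2).biUnion fun a =>
      parametersWithNormal r a).card : ℕ) : ℝ) ≤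
        (3 * (2 * (m : ℝ) + 5) ^ (m + 1) * r ^ m) ^ m := by
    rintro ⟨i₀, c⟩ hp
    have hc : c ≠ 0 := Finset.ne_of_mem_erase (Finset.mem_product.1 hp).2
    have hcpos : 0 < |(c : ℝ)| := abs_pos.2 (by exact_mod_cast hc)
    have hle : (((intShell i₀ c).biUnion fun a => parametersWithNormal r a).card : ℝ) ≤
        ∑ a ∈ intShell i₀ c, ((parametersWithNormal r a).card : ℝ) := by
      exact_mod_cast Finset.card_biUnion_le
    calc _ ≤ ∑ a ∈ intShell i₀ c, ((parametersWithNormal r a).card : ℝ) := hle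
      _ ≤ ∑ _a ∈ intShell i₀ c, ((2 * (m : ℝ) + 5) ^ (m + 1) * r ^ m / |(c : ℝ)|) ^ m := by
        refine Finset.sum_le_sum fun a ha => ?_
        have hac := apply_of_mem_intShell ha
        rw [← hac]
        exact card_parametersWithNormal_le hr i₀ (hac ▸ hc)
      _ = (intShell i₀ c).card * ((2 * (m : ℝ) + 5) ^ (m + 1) * r ^ m / |(c : ℝ)|) ^ m := by
        rw [Finset.sum_const, nsmul_eq_mul]
      _ ≤ (3 * |(c : ℝ)|) ^ m * ((2 * (m : ℝ) + 5) ^ (m + 1) * r ^ m / |(c : ℝ)|) ^ m := by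
        gcongr
        exact card_intShell_le i₀ hc
      _ = _ := by
        rw [← mul_pow]
        congr 1
        field_simp
  have hIcard : (I.card : ℝ) ≤ 2 * (m + 1) * X := by
    have h1 : ((Finset.Icc (-K) K).erase 0).card = ((K + 1 - -K).toNat - 1 : ℕ) := by
      rw [Finset.card_erase_of_mem (by simpa using hK0), Int.card_Icc]
    have h2 : (((Finset.Icc (-K) K).erase 0).card : ℤ) = 2 * K := by
      rw [h1]; omega
    have h3 : (((Finset.Icc (-K) K).erase 0).card : ℝ) = 2 * K := by exact_mod_cast h2
    have h4 : (K : ℝ) ≤ X := Int.floor_le X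
    rw [hI, Finset.card_product, Nat.cast_mul, h3, Finset.card_univ, Fintype.card_fin]
    push_cast
    nlinarith
  calc ((shortNormalParameters m r X).card : ℝ)
      ≤ ((I.biUnion fun p => (intShell p.1 p.2).biUnion fun a =>
          parametersWithNormal r a).card : ℝ) := by exact_mod_cast Finset.card_le_card hsub
    _ ≤ ∑ p ∈ I, (((intShell p.1 p.2).biUnion fun a => parametersWithNormal r a).card : ℝ) := by
      exact_mod_cast Finset.card_biUnion_le
    _ ≤ ∑ _p ∈ I, (3 * (2 * (m : ℝ) + 5) ^ (m + 1) * r ^ m) ^ m := Finset.sum_le_sum hterm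
    _ = I.card * (3 * (2 * (m : ℝ) + 5) ^ (m + 1) * r ^ m) ^ m := by
      rw [Finset.sum_const, nsmul_eq_mul]
    _ ≤ _ := by gcongr

/-! ### The number of hyperplanes from below -/

/-- If the normal vectors of size at most `δ * r ^ m` are excluded, every remaining hyperplane is
the span of at most `(C / δ) ^ m` families. -/
lemma card_sdiff_shortNormalParameters_le (m : ℕ) {r δ : ℝ} (hr : 1 ≤ r) (hδ : 0 < δ) :
    (((oddParameters m r \ shortNormalParameters m r (δ * r ^ m)).card : ℕ) : ℝ) ≤
      ((2 * (m : ℝ) + 5) ^ (m + 1) / δ) ^ m * (latticeHyperplanes_finite m r).toFinset.card := by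
  classical
  set G := oddParameters m r \ shortNormalParameters m r (δ * r ^ m) with hG
  set B : ℝ := ((2 * (m : ℝ) + 5) ^ (m + 1) / δ) ^ m with hB
  have hfib : ∀ H ∈ G.image fun u => intSpan (oddFamily u),
      (G.filter fun u => intSpan (oddFamily u) = H).card ≤ ⌊B⌋₊ := by
    intro H hH
    obtain ⟨u, hu, rfl⟩ := Finset.mem_image.1 hH
    obtain ⟨hu1, hu2⟩ := Finset.mem_sdiff.1 hu
    have hHyp := intSpan_oddFamily_mem hr hu1
    obtain ⟨a, ha, hua⟩ := exists_primitive_normal hHyp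
    obtain ⟨i₀, hi₀⟩ : ∃ i₀, δ * r ^ m < |(a i₀ : ℝ)| := by
      by_contra! hcon
      exact hu2 (Finset.mem_filter.2 ⟨hu1, a, ha, hua, hcon⟩)
    have h1 := card_oddParameters_fiber_le hr (intSpan (oddFamily u))
      (G.filter fun w => intSpan (oddFamily w) = intSpan (oddFamily u))
      ((Finset.filter_subset _ _).trans Finset.sdiff_subset)
      fun w hw => (Finset.mem_filter.1 hw).2
    have h2 := abs_normal_mul_card_sectionPoints_le hr ha (hua ▸ hHyp) i₀
    rw [← hua] at h2
    have h3 : ((sectionPoints r (intSpan (oddFamily u))).card : ℝ) ≤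
        (2 * (m : ℝ) + 5) ^ (m + 1) / δ := by
      have hrm : 0 < r ^ m := by positivity
      rw [le_div_iff₀ hδ]
      refine le_of_mul_le_mul_right ?_ hrm
      calc _ = δ * r ^ m * ((sectionPoints r (intSpan (oddFamily u))).card : ℝ) := by ring
        _ ≤ |(a i₀ : ℝ)| * ((sectionPoints r (intSpan (oddFamily u))).card : ℝ) := by gcongr
        _ ≤ _ := h2
    refine Nat.le_floor ?_
    calc _ ≤ ((sectionPoints r (intSpan (oddFamily u))).card : ℝ) ^ m := by exact_mod_cast h1
      _ ≤ B := by rw [hB]; gcongr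
  have h1 := Finset.card_le_mul_card_image G ⌊B⌋₊ hfib
  have h2 : (G.image fun u => intSpan (oddFamily u)).card ≤
      (latticeHyperplanes_finite m r).toFinset.card := by
    refine Finset.card_le_card fun H hH => ?_
    obtain ⟨u, hu, rfl⟩ := Finset.mem_image.1 hH
    rw [Set.Finite.mem_toFinset]
    exact intSpan_oddFamily_mem hr (Finset.mem_sdiff.1 hu).1
  calc (G.card : ℝ) ≤ ⌊B⌋₊ * ((G.image fun u => intSpan (oddFamily u)).card : ℝ) := by
        exact_mod_cast h1
    _ ≤ B * (latticeHyperplanes_finite m r).toFinset.card := by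
      gcongr
      exact Nat.floor_le (by positivity)

/-- There are at least `c * r ^ (n * (n - 1))` hyperplanes, where `n = m + 1`. -/
lemma exists_mul_pow_le_card_latticeHyperplanes (m : ℕ) :
    ∃ c : ℝ, 0 < c ∧ ∀ r : ℝ, 1 ≤ r →
      c * r ^ ((m + 1) * m) ≤ (latticeHyperplanes_finite m r).toFinset.card := by
  classical
  set q : ℝ := (1 / (4 * (m + 1) : ℝ)) ^ ((m + 1) * m) with hq
  set A : ℝ := (2 * (m : ℝ) + 5) ^ (m + 1) with hA
  have hqpos : 0 < q := by positivity
  have hApos : 0 < A := by positivity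
  -- With this `δ`, at most half of the guaranteed parameters have a short normal vector.
  set δ : ℝ := q / (4 * (m + 1) * (3 * A) ^ m) with hδ
  have hδpos : 0 < δ := by positivity
  refine ⟨q / 2 / (A / δ) ^ m, by positivity, fun r hr => ?_⟩
  have hr0 : 0 < r := by linarith
  have h1 := le_card_oddParameters m hr
  have h2 := card_shortNormalParameters_le m hr (X := δ * r ^ m) (by positivity)
  have h3 := card_sdiff_shortNormalParameters_le m hr hδpos
  have h4 : ((oddParameters m r).card : ℝ) ≤
      (shortNormalParameters m r (δ * r ^ m)).card +
        (oddParameters m r \ shortNormalParameters m r (δ * r ^ m)).card := by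
    have := Finset.card_le_card_sdiff_add_card (s := oddParameters m r)
      (t := shortNormalParameters m r (δ * r ^ m))
    rw [add_comm (Nat.cast _)]
    exact_mod_cast this
  have h5 : 2 * (m + 1) * (δ * r ^ m) * (3 * A * r ^ m) ^ m = q / 2 * r ^ ((m + 1) * m) := by
    rw [hδ, mul_pow (3 * A), ← pow_mul, add_mul, pow_add, one_mul]
    field_simp
    ring
  rw [h5] at h2
  rw [div_mul_eq_mul_div, div_le_iff₀ (by positivity)]
  linarith

/-- With `h` the number of hyperplanes and `n = m + 1`, the average is at most
`1 + m * (3 * r) ^ (n * m) / h`, while `h ≥ c * r ^ (n * m)`. -/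
lemma exists_averageLatticePoints_le (m : ℕ) :
    ∃ C : ℝ, ∀ r : ℝ, 1 ≤ r → (latticeHyperplanes (m + 1) r).Nonempty ∧
      averageLatticePoints (m + 1) r ≤ C := by
  obtain ⟨c, hc, hcr⟩ := exists_mul_pow_le_card_latticeHyperplanes m
  refine ⟨1 + m * 3 ^ ((m + 1) * m) / c, fun r hr => ?_⟩
  have h1 := hcr r hr
  have h2 := sum_card_sectionPoints_le m hr
  have hpos : (0 : ℝ) < (latticeHyperplanes_finite m r).toFinset.card :=
    lt_of_lt_of_le (mul_pos hc (pow_pos (by linarith) _)) h1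
  refine ⟨?_, ?_⟩
  · rw [← (latticeHyperplanes_finite m r).toFinset_nonempty, ← Finset.card_pos]
    exact_mod_cast hpos
  · rw [averageLatticePoints, finsum_mem_eq_finite_toFinset_sum _ (latticeHyperplanes_finite m r),
      Set.ncard_eq_toFinset_card _ (latticeHyperplanes_finite m r), one_div_mul_eq_div,
      div_le_iff₀ hpos]
    simp only [ncard_inter_latticeBall]
    refine h2.trans ?_
    have h3 : (m : ℝ) * 3 ^ ((m + 1) * m) / c * (c * r ^ ((m + 1) * m)) =
        m * (3 * r) ^ ((m + 1) * m) := by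
      rw [mul_pow]
      field_simp
    rw [one_add_mul, ← h3]
    gcongr

theorem mainTheorem4 (n : ℕ) (hn : 1 ≤ n) :
    ∃ C : ℝ, ∀ r : ℝ, 1 ≤ r →
      (latticeBall n r).Finite ∧
      (latticeHyperplanes n r).Finite ∧
      (latticeHyperplanes n r).Nonempty ∧
      averageLatticePoints n r ≤ C := by
  obtain ⟨m, rfl⟩ : ∃ m, n = m + 1 := ⟨n - 1, by omega⟩
  obtain ⟨C, hC⟩ := exists_averageLatticePoints_le m
  exact ⟨C, fun r hr => ⟨latticeBall_finite _ r, latticeHyperplanes_finite m r, hC r hr⟩⟩
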